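/- Let $n\ge 1$ and $0<d<r$. For a function $f$ on $\mathbb{R}^n$ and $y\in\mathbb{R}^n$ let $$Rf(y)=\int_{\{x\,:\,|x-y|=r\}} f\,\mathrm{d}S ,$$ where $\mathrm{d}S$ is surface measure on the sphere with centre $y$ and fixed radius $r$ (counting measure if $n=1$). Let $D'=\{x\in\mathbb{R}^n : d<|x|<r\}$ and $Y'=\{y\in\mathbb{R}^n : d+r<|y|<2r\}$, and let $L^2_c(D')$ be the space of complex-valued functions in $L^2(\mathbb{R}^n)$ whose support is a compact subset of $D'$ (for such $f$ the integral $Rf(y)$ converges absolutely for almost every $y$, and up to a null set of $y$ it depends only on the almost-everywhere class of $f$). Then the values $Rf(y)$, $y\in Y'$, determine $f\in L^2_c(D')$ uniquely: if $f,g\in L^2_c(D')$ and $Rf(y)=Rg(y)$ for almost every $y\in Y'$, then $f=g$ almost everywhere. -/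

import Mathlib

open MeasureTheory

/-- Surface measure on the sphere with centre `y` and radius `ρ` in `ℝⁿ`: the image of the
(unnormalised) surface measure of the unit sphere under `ω ↦ y + ρ ω`, scaled by `ρ ^ (n - 1)`. -/
noncomputable def sphereSurfaceMeasure {n : ℕ} (y : EuclideanSpace ℝ (Fin n)) (ρ : ℝ) :
    Measure (EuclideanSpace ℝ (Fin n)) :=
  ENNReal.ofReal (ρ ^ (n - 1)) •
    ((volume : Measure (EuclideanSpace ℝ (Fin n))).toSphere.map
      fun ω : Metric.sphere (0 : EuclideanSpace ℝ (Fin n)) 1 =>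
        y + ρ • (ω : EuclideanSpace ℝ (Fin n)))

/-- The spherical Radon transform with radius function `r`: the integral of `f` over the sphere
with centre `y` and radius `r y`, with respect to surface measure. -/
noncomputable def sphericalRadon {n : ℕ} (r : EuclideanSpace ℝ (Fin n) → ℝ)
    (f : EuclideanSpace ℝ (Fin n) → ℂ) (y : EuclideanSpace ℝ (Fin n)) : ℂ :=
  ∫ x, f x ∂(sphereSurfaceMeasure y (r y))

/-- The open annulus (spherical shell) `{x : a < |x| < b}` in `ℝⁿ`. -/
def openAnnulus (n : ℕ) (a b : ℝ) : Set (EuclideanSpace ℝ (Fin n)) :=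
  {x | a < ‖x‖ ∧ ‖x‖ < b}

/-- `f` is (a representative of) an element of `L²_c(U)`: it is square integrable on `ℝⁿ` and its
support, as a distribution, is a compact subset of `U`, that is, it vanishes almost everywhere
outside some compact subset of `U`. -/
def MemL2c {n : ℕ} (U : Set (EuclideanSpace ℝ (Fin n)))
    (f : EuclideanSpace ℝ (Fin n) → ℂ) : Prop :=
  MemLp f 2 volume ∧
    ∃ K : Set (EuclideanSpace ℝ (Fin n)), IsCompact K ∧ K ⊆ U ∧ ∀ᵐ x, x ∉ K → f x = 0

theorem lintegral_sphereSurfaceMeasure {n : ℕ} (ρ : ℝ) (g : EuclideanSpace ℝ (Fin n) → ENNReal)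
    (hg : Measurable g) :
    ∫⁻ y, ∫⁻ x, g x ∂(sphereSurfaceMeasure y ρ) =
      ENNReal.ofReal (ρ ^ (n - 1)) *
        ((volume : Measure (EuclideanSpace ℝ (Fin n))).toSphere Set.univ * ∫⁻ x, g x) := by
  have h1 : ∀ y : EuclideanSpace ℝ (Fin n), ∫⁻ x, g x ∂(sphereSurfaceMeasure y ρ) =
      ENNReal.ofReal (ρ ^ (n - 1)) *
        ∫⁻ ω : Metric.sphere (0 : EuclideanSpace ℝ (Fin n)) 1,
          g (y + ρ • (ω : EuclideanSpace ℝ (Fin n)))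
          ∂(volume : Measure (EuclideanSpace ℝ (Fin n))).toSphere := by
    intro y
    rw [sphereSurfaceMeasure, lintegral_smul_measure, lintegral_map hg (by fun_prop), smul_eq_mul]
  simp_rw [h1]
  rw [lintegral_const_mul' _ _ ENNReal.ofReal_ne_top, lintegral_lintegral_swap]
  · congr 1
    have h2 : ∀ ω : Metric.sphere (0 : EuclideanSpace ℝ (Fin n)) 1,
        ∫⁻ y : EuclideanSpace ℝ (Fin n), g (y + ρ • (ω : EuclideanSpace ℝ (Fin n))) =
          ∫⁻ x, g x := fun ω => lintegral_add_right_eq_self g _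
    simp_rw [h2]
    rw [lintegral_const, mul_comm]
  · exact (hg.comp (by fun_prop)).aemeasurable

/-- Changing `f` on a null set does not change it almost everywhere on almost every sphere of
radius `ρ`; hence the transform with constant radius is well defined on almost-everywhere
classes. -/
theorem ae_eq_sphereSurfaceMeasure {n : ℕ} (ρ : ℝ) {f g : EuclideanSpace ℝ (Fin n) → ℂ}
    (h : f =ᵐ[volume] g) : ∀ᵐ y, f =ᵐ[sphereSurfaceMeasure y ρ] g := by
  obtain ⟨s, hs, hsm, hs0⟩ := exists_measurable_superset_of_null (ae_iff.1 h)
  have h1 := lintegral_sphereSurfaceMeasure (n := n) ρ (s.indicator 1)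
    (measurable_one.indicator hsm)
  simp only [lintegral_indicator_one hsm, hs0, mul_zero] at h1
  have hmeas : Measurable fun y : EuclideanSpace ℝ (Fin n) => sphereSurfaceMeasure y ρ s := by
    have h2 : (fun y : EuclideanSpace ℝ (Fin n) => sphereSurfaceMeasure y ρ s) = fun y =>
        ENNReal.ofReal (ρ ^ (n - 1)) *
        ∫⁻ ω : Metric.sphere (0 : EuclideanSpace ℝ (Fin n)) 1,
          s.indicator (1 : EuclideanSpace ℝ (Fin n) → ENNReal)
            (y + ρ • (ω : EuclideanSpace ℝ (Fin n)))
          ∂(volume : Measure (EuclideanSpace ℝ (Fin n))).toSphere := by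
      funext y
      rw [← lintegral_indicator_one hsm, sphereSurfaceMeasure, lintegral_smul_measure,
        lintegral_map (measurable_one.indicator hsm) (by fun_prop), smul_eq_mul]
    rw [h2]
    refine Measurable.const_mul (Measurable.lintegral_prod_right' (f := fun p :
      EuclideanSpace ℝ (Fin n) × Metric.sphere (0 : EuclideanSpace ℝ (Fin n)) 1 =>
        s.indicator (1 : EuclideanSpace ℝ (Fin n) → ENNReal)
            (p.1 + ρ • (p.2 : EuclideanSpace ℝ (Fin n)))) ?_) _
    exact (measurable_one.indicator hsm).comp (by fun_prop)
  filter_upwards [(lintegral_eq_zero_iff hmeas).1 h1] with y hy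
  exact ae_iff.2 (measure_mono_null hs hy)

/-- For integrable `f`, the integral that defines the transform with constant radius converges
absolutely for almost every centre. -/
theorem ae_integrable_sphereSurfaceMeasure {n : ℕ} (ρ : ℝ) {f : EuclideanSpace ℝ (Fin n) → ℂ}
    (hf : Integrable f) : ∀ᵐ y, Integrable f (sphereSurfaceMeasure y ρ) := by
  have hm := hf.1.stronglyMeasurable_mk
  have h1 := lintegral_sphereSurfaceMeasure (n := n) ρ (fun x => ‖hf.1.mk f x‖ₑ) hm.enorm
  have hfin : ∫⁻ x, ‖hf.1.mk f x‖ₑ < ⊤ := (hf.congr hf.1.ae_eq_mk).2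
  have hne : ∫⁻ y, ∫⁻ x, ‖hf.1.mk f x‖ₑ ∂(sphereSurfaceMeasure y ρ) ≠ ⊤ := by
    rw [h1]
    exact ENNReal.mul_ne_top ENNReal.ofReal_ne_top
      (ENNReal.mul_ne_top (measure_ne_top _ _) hfin.ne)
  have hmeas : Measurable fun y : EuclideanSpace ℝ (Fin n) =>
      ∫⁻ x, ‖hf.1.mk f x‖ₑ ∂(sphereSurfaceMeasure y ρ) := by
    have h2 : (fun y : EuclideanSpace ℝ (Fin n) =>
        ∫⁻ x, ‖hf.1.mk f x‖ₑ ∂(sphereSurfaceMeasure y ρ)) = fun y =>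
        ENNReal.ofReal (ρ ^ (n - 1)) *
        ∫⁻ ω : Metric.sphere (0 : EuclideanSpace ℝ (Fin n)) 1,
          ‖hf.1.mk f (y + ρ • (ω : EuclideanSpace ℝ (Fin n)))‖ₑ
          ∂(volume : Measure (EuclideanSpace ℝ (Fin n))).toSphere := by
      funext y
      rw [sphereSurfaceMeasure, lintegral_smul_measure,
        lintegral_map hm.enorm (by fun_prop), smul_eq_mul]
    rw [h2]
    refine Measurable.const_mul (Measurable.lintegral_prod_right' (f := fun p :
      EuclideanSpace ℝ (Fin n) × Metric.sphere (0 : EuclideanSpace ℝ (Fin n)) 1 =>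
        ‖hf.1.mk f (p.1 + ρ • (p.2 : EuclideanSpace ℝ (Fin n)))‖ₑ) ?_) _
    exact Measurable.comp (g := fun x => ‖hf.1.mk f x‖ₑ) hm.enorm (by fun_prop)
  filter_upwards [ae_lt_top hmeas hne, ae_eq_sphereSurfaceMeasure ρ hf.1.ae_eq_mk] with y hy hy'
  exact Integrable.congr ⟨hm.aestronglyMeasurable, hy⟩ hy'.symm

theorem MemL2c.integrable {n : ℕ} {U : Set (EuclideanSpace ℝ (Fin n))}
    {f : EuclideanSpace ℝ (Fin n) → ℂ} (hf : MemL2c U f) : Integrable f := by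
  obtain ⟨h2, K, hK, -, h0⟩ := hf
  have hi : IntegrableOn f K := by
    have : IsFiniteMeasure (volume.restrict K) := ⟨by simpa using hK.measure_lt_top⟩
    exact (h2.restrict K).integrable (by norm_num)
  refine ((integrable_indicator_iff hK.measurableSet).2 hi).congr ?_
  filter_upwards [h0] with x hx
  by_cases hxK : x ∈ K
  · simp [hxK]
  · simp [hxK, hx hxK]

/-!
The statement is a support theorem for convolutions, in the spirit of Titchmarsh. The transform
with fixed radius `r` is convolution with the surface measure `σ` of the sphere of radius `r`. Let
`h = f - g`. It lives in `‖x‖ < r`, so `h * σ` vanishes at every `y` with `‖y‖ ≥ 2 r`, and by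
hypothesis also on the shell `d + r < ‖y‖ < 2 r`: `h * σ` lives in the ball of radius `d + r`. Since
the convex hull of `supp σ` is the ball of radius `r`, the support of `h` must lie in the ball of
radius `d`, and there `h` is zero by assumption.

The support of `h` is located one half-space at a time. Fix a unit vector `e`, a frequency `η`, and
integrate against the plane waves `x ↦ exp (i ⟪η, x⟫ + t ⟪e, x⟫)`. As these are multiplicative,
the integral of `h * σ` is that of `h` times that of `σ` (`integral_mul_sphericalRadon`). For
`t → ∞` the integral of `h * σ` is `O(exp ((d + r) t))`, while that of `σ` is at least
`c exp ((r - ε) t)`, because `⟪e, ·⟫` has a strict maximum over the sphere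
(`exists_exp_le_norm_integral`). So the integral of `h` is `O(exp ((d + ε) t))`
(`exists_norm_integral_planeWave_mul_le`).

Consequently, with `d' = d + ε`, the entire function
`z ↦ ∫ h(x) exp (i ⟪η, x⟫) exp (z (⟪e, x⟫ - d'))`, the integral being over `⟪e, x⟫ > d'`, is bounded
on the positive real axis. It is bounded on `re z ≤ 0` and of exponential type, hence bounded by
Phragmén-Lindelöf, hence constant by Liouville, and it tends to `0` at `-∞`; so it is zero
(`integral_eq_zero_of_isBoundedUnder_exp`). At `z = 0` this says that the Fourier transform of
`h` restricted to the half-space `⟪e, x⟫ > d'` vanishes, so `h = 0` almost everywhere there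
(`ae_eq_zero_of_lt_inner`). The half-spaces with `d' > d` cover `‖x‖ > d`.
-/

/-! ### Integrals of exponentials -/

open Filter Set Topology Complex Bornology in
/-- If a Laplace transform `z ↦ ∫ k exp (z v)` with exponents `v` in `(0, M]` stays bounded as
`z → +∞` along the reals, then it is a bounded entire function that tends to `0` at `-∞`, hence
it vanishes; the conclusion is its value at `0`. -/
theorem integral_eq_zero_of_isBoundedUnder_exp {α : Type*} [MeasurableSpace α] {μ : Measure α}
    {k : α → ℂ} (hk : Integrable k μ) {v : α → ℝ} (hv : Measurable v) {M : ℝ}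
    (hkv : ∀ x, k x ≠ 0 → 0 < v x ∧ v x ≤ M)
    (hb : IsBoundedUnder (· ≤ ·) atTop fun t : ℝ => ‖∫ x, k x * cexp (t * v x) ∂μ‖) :
    ∫ x, k x ∂μ = 0 := by
  wlog hM : 0 ≤ M generalizing M
  · exact this (M := 0) (fun x hx => ⟨(hkv x hx).1, (hkv x hx).2.trans (not_le.1 hM).le⟩) le_rfl
  set G : ℂ → ℂ := fun z => ∫ x, k x * cexp (z * v x) ∂μ with hG
  have hnorm : ∀ (z : ℂ) x, ‖k x * cexp (z * v x)‖ = ‖k x‖ * Real.exp (z.re * v x) := by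
    intro z x
    rw [norm_mul, Complex.norm_exp, re_mul_ofReal]
  have hmeas : ∀ z : ℂ, AEStronglyMeasurable (fun x => k x * cexp (z * v x)) μ := fun z =>
    hk.1.mul (by fun_prop : Measurable fun x => cexp (z * v x)).aestronglyMeasurable
  have hle : ∀ (z : ℂ) x, ‖k x * cexp (z * v x)‖ ≤ Real.exp (M * ‖z‖) * ‖k x‖ := by
    intro z x
    rw [hnorm, mul_comm]
    by_cases hx : k x = 0
    · simp [hx]
    have h1 := (le_abs_self z.re).trans (abs_re_le_norm z)
    have h2 : z.re * v x ≤ M * ‖z‖ := by nlinarith [hkv x hx, norm_nonneg z]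
    gcongr
  have hleft : ∀ (z : ℂ), z.re ≤ 0 → ∀ x, ‖k x * cexp (z * v x)‖ ≤ ‖k x‖ := by
    intro z hz x
    rw [hnorm]
    by_cases hx : k x = 0
    · simp [hx]
    refine mul_le_of_le_one_right (norm_nonneg _) (Real.exp_le_one_iff.2 ?_)
    exact mul_nonpos_of_nonpos_of_nonneg hz (hkv x hx).1.le
  have hint : ∀ z : ℂ, Integrable (fun x => k x * cexp (z * v x)) μ := fun z =>
    (hk.norm.const_mul _).mono' (hmeas z) (ae_of_all _ (hle z))
  have hdiff : Differentiable ℂ G := by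
    intro z
    refine (hasDerivAt_integral_of_dominated_loc_of_deriv_le (𝕜 := ℂ)
      (F' := fun z x => k x * (cexp (z * v x) * v x))
      (bound := fun x => M * (Real.exp (M * (‖z‖ + 1)) * ‖k x‖))
      (Metric.ball_mem_nhds z one_pos) (Eventually.of_forall hmeas) (hint z) ?_ ?_ ?_
      ?_).2.differentiableAt
    · exact hk.1.mul (by fun_prop : Measurable fun x =>
        cexp (z * v x) * v x).aestronglyMeasurable
    · refine ae_of_all _ fun x w hw => ?_
      have h1 : ‖w‖ ≤ ‖z‖ + 1 := by
        have h3 := norm_sub_norm_le w z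
        rw [mem_ball_iff_norm] at hw
        linarith
      have h2 := hle w x
      rw [← mul_assoc, norm_mul, mul_comm, norm_real]
      by_cases hx : k x = 0
      · simp [hx]
      refine mul_le_mul ?_ (h2.trans ?_) (norm_nonneg _) hM
      · rw [Real.norm_of_nonneg (hkv x hx).1.le]
        exact (hkv x hx).2
      · gcongr
    · exact (hk.norm.const_mul _).const_mul _
    · refine ae_of_all _ fun x w _ => ?_
      have h1 : HasDerivAt (fun w : ℂ => w * (v x : ℂ)) (v x : ℂ) w := by
        simpa using (hasDerivAt_id w).mul_const (v x : ℂ)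
      exact h1.cexp.const_mul (k x)
  have hGleft : ∀ z : ℂ, z.re ≤ 0 → ‖G z‖ ≤ ∫ x, ‖k x‖ ∂μ := fun z hz =>
    norm_integral_le_of_norm_le hk.norm (ae_of_all _ (hleft z hz))
  have hGright : ∀ z : ℂ, 0 ≤ z.re → ‖G z‖ ≤ ∫ x, ‖k x‖ ∂μ := by
    intro z hz
    refine PhragmenLindelof.right_half_plane_of_bounded_on_real hdiff.diffContOnCl
      ⟨1, by norm_num, M, ?_⟩ hb (fun x => hGleft _ (by simp)) hz
    refine Asymptotics.IsBigO.of_bound (∫ x, ‖k x‖ ∂μ) (Eventually.of_forall fun w => ?_)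
    rw [Real.rpow_one, Real.norm_of_nonneg (Real.exp_pos _).le, mul_comm, ← integral_const_mul]
    exact norm_integral_le_of_norm_le (hk.norm.const_mul _) (ae_of_all _ (hle w))
  have hbdd : IsBounded (range G) := by
    refine (Metric.isBounded_closedBall (x := (0 : ℂ)) (r := ∫ x, ‖k x‖ ∂μ)).subset ?_
    rintro _ ⟨z, rfl⟩
    rw [mem_closedBall_zero_iff]
    rcases le_total z.re 0 with h | h
    exacts [hGleft z h, hGright z h]
  have hlim : Tendsto (fun t : ℝ => G (-t : ℝ)) atTop (𝓝 0) := by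
    rw [← integral_zero α ℂ (μ := μ)]
    refine tendsto_integral_filter_of_dominated_convergence (fun x => ‖k x‖)
      (Eventually.of_forall fun t => hmeas _) ?_ hk.norm (ae_of_all _ fun x => ?_)
    · filter_upwards [eventually_ge_atTop 0] with t ht
      exact ae_of_all _ (hleft _ (by simpa using ht))
    · by_cases hx : k x = 0
      · simp [hx]
      rw [tendsto_zero_iff_norm_tendsto_zero]
      simp_rw [hnorm, ofReal_re]
      rw [← mul_zero ‖k x‖]
      refine Tendsto.const_mul _ (Real.tendsto_exp_atBot.comp ?_)
      exact tendsto_neg_atTop_atBot.atBot_mul_const (hkv x hx).1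
  have h0 : ∀ t : ℝ, G (-t : ℝ) = G 0 := fun t => hdiff.apply_eq_apply_of_bounded hbdd _ _
  simp_rw [h0] at hlim
  have := tendsto_nhds_unique tendsto_const_nhds hlim
  simpa [hG] using this

open Filter Set Topology Complex in
/-- Lower bound of Laplace type: if `u` has a strict maximum at `x₀` and the amplitude `φ` does not
vanish there, then `∫ φ exp (t u)` eventually dominates a multiple of `exp (b t)`, for every
`b < u x₀`. -/
theorem exists_exp_le_norm_integral {X : Type*} [TopologicalSpace X] [CompactSpace X]
    [MeasurableSpace X] [BorelSpace X] {τ : Measure X} [IsFiniteMeasure τ] [τ.IsOpenPosMeasure]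
    {u : X → ℝ} (hu : Continuous u) {φ : X → ℂ} (hφ : Continuous φ) {x₀ : X}
    (hmax : ∀ x, x ≠ x₀ → u x < u x₀) (hφ₀ : φ x₀ ≠ 0) {b : ℝ} (hb : b < u x₀) :
    ∃ c > 0, ∀ᶠ t : ℝ in atTop, c * Real.exp (b * t) ≤ ‖∫ x, φ x * cexp (t * u x) ∂τ‖ := by
  wlog h1 : φ x₀ = 1 generalizing φ
  · obtain ⟨c, hc, h⟩ := this (φ := fun x => (φ x₀)⁻¹ * φ x) (by fun_prop)
      (by simp [hφ₀]) (by simp [hφ₀])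
    refine ⟨‖φ x₀‖ * c, by positivity, h.mono fun t ht => ?_⟩
    simp_rw [mul_assoc] at ht ⊢
    rw [integral_const_mul, norm_mul, norm_inv] at ht
    have hp : 0 < ‖φ x₀‖ := norm_pos_iff.2 hφ₀
    rwa [inv_mul_eq_div, le_div_iff₀' hp] at ht
  -- Near `x₀` the real part of the integrand is at least `exp (t u) / 2`; away from it, `u` stays
  -- below some `m < u x₀`, so the rest of the integral is of smaller exponential order.
  set V : Set X := {x | 1 / 2 < (φ x).re} with hV
  have hVo : IsOpen V := isOpen_lt continuous_const (by fun_prop)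
  have hx₀V : x₀ ∈ V := by
    simp only [hV, mem_ofPred_eq, h1]
    norm_num
  obtain ⟨m, hm, hmV⟩ : ∃ m < u x₀, ∀ x ∉ V, u x ≤ m := by
    rcases (Vᶜ).eq_empty_or_nonempty with h | h
    · exact ⟨b, hb, fun x hx => absurd (show x ∈ Vᶜ from hx) (by simp [h])⟩
    · obtain ⟨y, hy, hy'⟩ := hVo.isClosed_compl.isCompact.exists_isMaxOn h hu.continuousOn
      refine ⟨u y, hmax y ?_, fun x hx => hy' hx⟩
      rintro rfl
      exact hy hx₀V
  obtain ⟨C, hC⟩ : ∃ C, ∀ x, ‖φ x‖ ≤ C := by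
    obtain ⟨C, hC⟩ := isCompact_univ.exists_bound_of_continuousOn hφ.continuousOn
    exact ⟨C, fun x => hC x (mem_univ x)⟩
  have hC0 : 0 ≤ C := (norm_nonneg _).trans (hC x₀)
  obtain ⟨b', hb'1, hb'2⟩ := exists_between (max_lt hm hb)
  obtain ⟨hmb', hbb'⟩ := max_lt_iff.1 hb'1
  set W : Set X := V ∩ {x | b' < u x} with hW
  have hWo : IsOpen W := hVo.inter (isOpen_lt continuous_const hu)
  have hWpos : 0 < τ.real W :=
    ENNReal.toReal_pos (hWo.measure_pos τ ⟨x₀, hx₀V, hb'2⟩).ne' (measure_ne_top _ _)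
  have hint : ∀ t : ℝ, Integrable (fun x => φ x * cexp (t * u x)) τ := fun t =>
    (by fun_prop : Continuous fun x => φ x * cexp (t * u x)).integrable_of_hasCompactSupport
      (HasCompactSupport.of_compactSpace _)
  have hre : ∀ (t : ℝ) x, (φ x * cexp (t * u x)).re = (φ x).re * Real.exp (t * u x) := by
    intro t x
    rw [← ofReal_mul, ← ofReal_exp, re_mul_ofReal]
  have hlow : ∀ t : ℝ, 0 ≤ t → τ.real W * (1 / 2 * Real.exp (b' * t)) -
      τ.real univ * (C * Real.exp (m * t)) ≤ ‖∫ x, φ x * cexp (t * u x) ∂τ‖ := by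
    intro t ht
    have h2 : ∫ x, (W.indicator (fun _ => 1 / 2 * Real.exp (b' * t)) x - C * Real.exp (m * t)) ∂τ
        = τ.real W * (1 / 2 * Real.exp (b' * t)) - τ.real univ * (C * Real.exp (m * t)) := by
      rw [integral_sub ((integrable_const _).indicator hWo.measurableSet) (integrable_const _),
        integral_indicator_const _ hWo.measurableSet, integral_const, smul_eq_mul, smul_eq_mul]
    rw [← h2]
    refine le_trans ?_ (re_le_norm _)
    rw [← reCLM_apply, ← ContinuousLinearMap.integral_comp_comm _ (hint t)]
    refine integral_mono (((integrable_const _).indicator hWo.measurableSet).sub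
      (integrable_const _)) (reCLM.integrable_comp (hint t)) fun x => ?_
    simp only [reCLM_apply, hre]
    have hCe : 0 ≤ C * Real.exp (m * t) := by positivity
    by_cases hxV : x ∈ V
    · have h3 : 1 / 2 * Real.exp (t * u x) ≤ (φ x).re * Real.exp (t * u x) := by
        have : 1 / 2 < (φ x).re := hxV
        gcongr
      by_cases hxW : x ∈ W
      · rw [indicator_of_mem hxW]
        have h4 : Real.exp (b' * t) ≤ Real.exp (t * u x) := by
          rw [mul_comm]
          have : b' < u x := hxW.2
          gcongr
        linarith
      · rw [indicator_of_notMem hxW]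
        have := Real.exp_pos (t * u x)
        linarith
    · rw [indicator_of_notMem fun h => hxV h.1]
      have h3 : Real.exp (t * u x) ≤ Real.exp (m * t) := by
        rw [mul_comm]
        have := hmV x hxV
        gcongr
      have h4 : -C ≤ (φ x).re := by
        have := abs_le.1 ((abs_re_le_norm (φ x)).trans (hC x))
        exact this.1
      have h5 := mul_le_mul_of_nonneg_left h3 hC0
      have h6 := mul_le_mul_of_nonneg_right h4 (Real.exp_pos (t * u x)).le
      linarith
  refine ⟨τ.real W / 4, by positivity, ?_⟩
  have hsmall : Tendsto (fun t : ℝ => τ.real univ * C * Real.exp (-((b' - m) * t))) atTop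
      (𝓝 0) := by
    rw [← mul_zero (τ.real univ * C)]
    exact (Real.tendsto_exp_neg_atTop_nhds_zero.comp
      (tendsto_id.const_mul_atTop (sub_pos.2 hmb'))).const_mul _
  filter_upwards [eventually_ge_atTop 0,
    hsmall.eventually (gt_mem_nhds (show 0 < τ.real W / 4 by positivity))] with t ht hts
  refine le_trans ?_ (hlow t ht)
  have h7 : Real.exp (b * t) ≤ Real.exp (b' * t) := by gcongr
  have h8 : Real.exp (m * t) = Real.exp (-((b' - m) * t)) * Real.exp (b' * t) := by
    rw [← Real.exp_add]
    ring_nf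
  have h9 := mul_le_mul_of_nonneg_right hts.le (Real.exp_pos (b' * t)).le
  have h10 := mul_le_mul_of_nonneg_left h7 hWpos.le
  rw [h8]
  nlinarith

open Real FourierTransform in
/-- An integrable function whose Fourier transform vanishes identically is zero almost everywhere.
It is tested against a smooth compactly supported `g`, which is the Fourier transform of a
Schwartz function. -/
theorem ae_eq_zero_of_integral_char_eq_zero {V : Type*} [NormedAddCommGroup V]
    [InnerProductSpace ℝ V] [FiniteDimensional ℝ V] [MeasurableSpace V] [BorelSpace V]
    {f : V → ℂ} (hf : Integrable f)
    (h : ∀ η : V, ∫ x, f x * Complex.exp ((inner ℝ η x : ℝ) * Complex.I) = 0) :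
    f =ᵐ[volume] 0 := by
  have hF : 𝓕 f = 0 := by
    funext w
    rw [Real.fourier_eq', Pi.zero_apply, ← h ((-2 * π) • w)]
    congr 1 with x
    rw [smul_eq_mul, mul_comm, inner_smul_left, real_inner_comm]
    simp
  refine ae_eq_zero_of_integral_contDiff_smul_eq_zero hf.locallyIntegrable fun g hg hgc => ?_
  have hgc' : HasCompactSupport fun x => (g x : ℂ) := hgc.comp_left Complex.ofReal_zero
  let φ : SchwartzMap V ℂ := hgc'.toSchwartzMap (Complex.ofRealCLM.contDiff.comp hg)
  let ψ : SchwartzMap V ℂ := 𝓕⁻ φ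
  have h1 := VectorFourier.integral_fourierIntegral_smul_eq_flip (L := innerₗ V)
    (μ := volume) (ν := volume) Real.continuous_fourierChar continuous_inner hf ψ.integrable
  have h2 : 𝓕 (ψ : V → ℂ) = fun x => (g x : ℂ) := by
    rw [← SchwartzMap.fourier_coe, FourierTransform.fourier_fourierInv_eq]
    rfl
  have h3 : ∫ x, f x • 𝓕 (ψ : V → ℂ) x = ∫ x, 𝓕 f x • ψ x := by
    rw [flip_innerₗ] at h1
    exact h1.symm
  rw [h2, hF] at h3
  simpa [mul_comm] using h3

/-! ### The spherical transform against plane waves -/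

theorem sphericalRadon_const_eq {n : ℕ} (r : ℝ) (hr : 0 ≤ r) {h : EuclideanSpace ℝ (Fin n) → ℂ}
    (hh : StronglyMeasurable h) (y : EuclideanSpace ℝ (Fin n)) :
    sphericalRadon (fun _ => r) h y = (r ^ (n - 1) : ℝ) *
      ∫ ω : Metric.sphere (0 : EuclideanSpace ℝ (Fin n)) 1,
        h (y + r • (ω : EuclideanSpace ℝ (Fin n)))
        ∂(volume : Measure (EuclideanSpace ℝ (Fin n))).toSphere := by
  rw [sphericalRadon, sphereSurfaceMeasure, integral_smul_measure,
    integral_map (by fun_prop) hh.aestronglyMeasurable, ENNReal.toReal_ofReal (by positivity),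
    Complex.real_smul]

/-- The transform with constant radius is convolution with surface measure, so integrating it
against a multiplicative `w` gives a product. -/
theorem integral_mul_sphericalRadon {n : ℕ} {r : ℝ} (hr : 0 ≤ r)
    {h w : EuclideanSpace ℝ (Fin n) → ℂ} (hh : StronglyMeasurable h) (hw : Continuous w)
    (hadd : ∀ x y, w (x + y) = w x * w y) (hwh : Integrable fun x => w x * h x) :
    (Integrable fun y => w y * sphericalRadon (fun _ => r) h y) ∧
    ∫ y, w y * sphericalRadon (fun _ => r) h y = (r ^ (n - 1) : ℝ) *
      ((∫ ω : Metric.sphere (0 : EuclideanSpace ℝ (Fin n)) 1,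
        w (-(r • (ω : EuclideanSpace ℝ (Fin n))))
        ∂(volume : Measure (EuclideanSpace ℝ (Fin n))).toSphere) * ∫ x, w x * h x) := by
  set τ := (volume : Measure (EuclideanSpace ℝ (Fin n))).toSphere
  set F : EuclideanSpace ℝ (Fin n) × Metric.sphere (0 : EuclideanSpace ℝ (Fin n)) 1 → ℂ :=
    fun p => w p.1 * h (p.1 + r • (p.2 : EuclideanSpace ℝ (Fin n)))
  have hF : ∀ y (ω : Metric.sphere (0 : EuclideanSpace ℝ (Fin n)) 1), F (y, ω) =
      w (-(r • (ω : EuclideanSpace ℝ (Fin n)))) *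
        (w (y + r • (ω : EuclideanSpace ℝ (Fin n))) *
          h (y + r • (ω : EuclideanSpace ℝ (Fin n)))) := by
    intro y ω
    rw [← mul_assoc, ← hadd, neg_add_cancel_comm_assoc]
  have hFm : AEStronglyMeasurable F (volume.prod τ) := by
    have h1 : Measurable h := hh.measurable
    have h2 : Measurable F := Measurable.mul (by fun_prop) (h1.comp (by fun_prop))
    exact h2.aestronglyMeasurable
  have hFi : Integrable F (volume.prod τ) := by
    rw [integrable_prod_iff' hFm]
    refine ⟨ae_of_all _ fun ω => ?_, ?_⟩
    · simp_rw [hF]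
      exact (hwh.comp_add_right _).const_mul _
    · have h1 : ∀ ω : Metric.sphere (0 : EuclideanSpace ℝ (Fin n)) 1, ∫ y, ‖F (y, ω)‖ =
          ‖w (-(r • (ω : EuclideanSpace ℝ (Fin n))))‖ * ∫ x, ‖w x * h x‖ := by
        intro ω
        simp_rw [hF, norm_mul (w (-(r • (ω : EuclideanSpace ℝ (Fin n))))), integral_const_mul]
        rw [integral_add_right_eq_self (fun x => ‖w x * h x‖)]
      simp_rw [h1]
      exact Continuous.integrable_of_hasCompactSupport (by fun_prop)
        (HasCompactSupport.of_compactSpace _)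
  have hR : ∀ y, w y * sphericalRadon (fun _ => r) h y =
      (r ^ (n - 1) : ℝ) * ∫ ω, F (y, ω) ∂τ := by
    intro y
    rw [sphericalRadon_const_eq r hr hh, mul_left_comm, ← integral_const_mul]
  simp_rw [hR]
  refine ⟨hFi.integral_prod_left.const_mul _, ?_⟩
  rw [integral_const_mul, integral_integral_swap hFi]
  congr 1
  rw [← integral_mul_const]
  congr 1 with ω
  simp_rw [hF]
  rw [integral_const_mul, integral_add_right_eq_self (fun x => w x * h x)]

/-- The exponential `x ↦ exp (i ⟪η, x⟫ + z ⟪e, x⟫)`, with real frequency `η` and complex growth rate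
`z` in the direction `e`. -/
noncomputable def planeWave {V : Type*} [NormedAddCommGroup V] [InnerProductSpace ℝ V]
    (η e : V) (z : ℂ) (x : V) : ℂ :=
  Complex.exp ((inner ℝ η x : ℝ) * Complex.I) * Complex.exp (z * (inner ℝ e x : ℝ))

section planeWave

variable {V : Type*} [NormedAddCommGroup V] [InnerProductSpace ℝ V] (η e : V)

theorem continuous_planeWave (z : ℂ) : Continuous (planeWave η e z) := by
  unfold planeWave
  fun_prop

theorem planeWave_add (z : ℂ) (x y : V) :
    planeWave η e z (x + y) = planeWave η e z x * planeWave η e z y := by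
  simp only [planeWave, inner_add_right, Complex.ofReal_add, add_mul, mul_add, Complex.exp_add]
  ring

theorem norm_planeWave (t : ℝ) (x : V) :
    ‖planeWave η e t x‖ = Real.exp (t * inner ℝ e x) := by
  rw [planeWave, norm_mul, Complex.norm_exp_ofReal_mul_I, one_mul, Complex.norm_exp,
    ← Complex.ofReal_mul, Complex.ofReal_re]

end planeWave

theorem integrable_planeWave_mul {n : ℕ} {M : ℝ} {h : EuclideanSpace ℝ (Fin n) → ℂ}
    (hi : Integrable h) (hM : ∀ x, h x ≠ 0 → ‖x‖ ≤ M) (η : EuclideanSpace ℝ (Fin n))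
    {e : EuclideanSpace ℝ (Fin n)} (he : ‖e‖ = 1) {t : ℝ} (ht : 0 ≤ t) :
    Integrable fun x => planeWave η e t x * h x := by
  refine (hi.norm.const_mul (Real.exp (t * M))).mono'
    ((continuous_planeWave η e t).aestronglyMeasurable.mul hi.1) (ae_of_all _ fun x => ?_)
  rw [norm_mul, norm_planeWave]
  by_cases hx : h x = 0
  · simp [hx]
  have h1 : inner ℝ e x ≤ M := by
    have := real_inner_le_norm e x
    rw [he, one_mul] at this
    exact this.trans (hM x hx)
  gcongr

/-! ### Half-spaces on which the function vanishes -/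

open Filter in
/-- If the transform of `h` vanishes beyond radius `d + r`, the exponential integrals of `h` in any
direction grow, up to an arbitrarily small loss in the rate, no faster than if `h` were supported in
the ball of radius `d`. -/
theorem exists_norm_integral_planeWave_mul_le {n : ℕ} {d r M : ℝ} (hr : 0 < r)
    {h : EuclideanSpace ℝ (Fin n) → ℂ} (hh : StronglyMeasurable h) (hi : Integrable h)
    (hM : ∀ x, h x ≠ 0 → ‖x‖ ≤ M)
    (hR : ∀ᵐ y, d + r < ‖y‖ → sphericalRadon (fun _ => r) h y = 0)
    (η : EuclideanSpace ℝ (Fin n)) {e : EuclideanSpace ℝ (Fin n)} (he : ‖e‖ = 1)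
    {d' : ℝ} (hd' : d < d') :
    ∃ C, ∀ᶠ t : ℝ in atTop, ‖∫ x, planeWave η e t x * h x‖ ≤ C * Real.exp (d' * t) := by
  have hup : ∀ t : ℝ, 0 ≤ t → ‖∫ y, planeWave η e t y * sphericalRadon (fun _ => r) h y‖ ≤
      Real.exp ((d + r) * t) * ∫ y, ‖sphericalRadon (fun _ => r) h y‖ := by
    intro t ht
    have hRi : Integrable (sphericalRadon (fun _ => r) h) := by
      simpa using (integral_mul_sphericalRadon hr.le (w := fun _ => 1) hh continuous_const
        (by simp) (by simpa using hi)).1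
    rw [← integral_const_mul]
    refine norm_integral_le_of_norm_le (hRi.norm.const_mul _) ?_
    filter_upwards [hR] with y hy
    rw [norm_mul, norm_planeWave]
    by_cases hy' : d + r < ‖y‖
    · simp [hy hy']
    have h1 : inner ℝ e y ≤ d + r := by
      have := real_inner_le_norm e y
      rw [he, one_mul] at this
      exact this.trans (not_lt.1 hy')
    rw [mul_comm t]
    gcongr
  -- The sphere enters through the points `-(r • ω)`, on which `⟪e, ·⟫` is largest at `ω = -e`.
  let x₀ : Metric.sphere (0 : EuclideanSpace ℝ (Fin n)) 1 := ⟨-e, by simp [he]⟩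
  have hx₀ : inner ℝ e (-(r • (x₀ : EuclideanSpace ℝ (Fin n)))) = r := by
    simp [x₀, inner_smul_right, he]
  have hmax : ∀ ω : Metric.sphere (0 : EuclideanSpace ℝ (Fin n)) 1, ω ≠ x₀ →
      inner ℝ e (-(r • (ω : EuclideanSpace ℝ (Fin n)))) <
        inner ℝ e (-(r • (x₀ : EuclideanSpace ℝ (Fin n)))) := by
    intro ω hω
    have hω1 : ‖(ω : EuclideanSpace ℝ (Fin n))‖ = 1 := by simp
    have h1 : inner ℝ e (-(ω : EuclideanSpace ℝ (Fin n))) < 1 := by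
      rw [inner_lt_one_iff_real_of_norm_eq_one he (by rw [norm_neg, hω1])]
      intro h2
      exact hω (Subtype.ext (by simp [x₀, h2]))
    rw [hx₀, ← smul_neg, inner_smul_right]
    nlinarith
  obtain ⟨c, hc, hlow⟩ := exists_exp_le_norm_integral
    (τ := (volume : Measure (EuclideanSpace ℝ (Fin n))).toSphere)
    (u := fun ω => inner ℝ e (-(r • (ω : EuclideanSpace ℝ (Fin n)))))
    (φ := fun ω => Complex.exp ((inner ℝ η (-(r • (ω : EuclideanSpace ℝ (Fin n)))) : ℝ) *
      Complex.I)) (x₀ := x₀) (b := r - (d' - d)) (by fun_prop) (by fun_prop) hmax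
      (Complex.exp_ne_zero _) (by rw [hx₀]; linarith)
  set Q := ∫ y, ‖sphericalRadon (fun _ => r) h y‖
  refine ⟨Q / (r ^ (n - 1) * c), ?_⟩
  filter_upwards [hlow, eventually_ge_atTop 0] with t h1 ht
  have h2 := hup t ht
  rw [(integral_mul_sphericalRadon hr.le hh (continuous_planeWave η e t)
    (planeWave_add η e t) (integrable_planeWave_mul hi hM η he ht)).2, norm_mul, norm_mul,
    Complex.norm_real, Real.norm_of_nonneg (by positivity)] at h2
  set A := ‖∫ x, planeWave η e t x * h x‖
  have h3 : r ^ (n - 1) * (c * Real.exp ((r - (d' - d)) * t) * A) ≤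
      Real.exp ((d + r) * t) * Q := by
    refine le_trans ?_ h2
    have := norm_nonneg (∫ x, planeWave η e t x * h x)
    gcongr
    exact h1
  -- The rate `r - (d' - d)` of the lower bound is chosen to be `(d + r) - d'`.
  have h4 : Real.exp ((d + r) * t) = Real.exp (d' * t) * Real.exp ((r - (d' - d)) * t) := by
    rw [← Real.exp_add]
    ring_nf
  rw [h4] at h3
  rw [div_mul_eq_mul_div, le_div_iff₀ (by positivity)]
  have h5 := Real.exp_pos ((r - (d' - d)) * t)
  refine le_of_mul_le_mul_right ?_ h5
  linarith

open Filter in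
/-- If the transform of `h` vanishes beyond radius `d + r`, then `h` vanishes on every half-space
at distance more than `d` from the origin. -/
theorem ae_eq_zero_of_lt_inner {n : ℕ} {d r M : ℝ} (hr : 0 < r)
    {h : EuclideanSpace ℝ (Fin n) → ℂ} (hh : StronglyMeasurable h) (hi : Integrable h)
    (hM : ∀ x, h x ≠ 0 → ‖x‖ ≤ M)
    (hR : ∀ᵐ y, d + r < ‖y‖ → sphericalRadon (fun _ => r) h y = 0)
    {e : EuclideanSpace ℝ (Fin n)} (he : ‖e‖ = 1) {d' : ℝ} (hd' : d < d') :
    ∀ᵐ x, d' < inner ℝ e x → h x = 0 := by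
  set S : Set (EuclideanSpace ℝ (Fin n)) := {x | d' < inner ℝ e x} with hS
  have hSm : MeasurableSet S := measurableSet_lt (by fun_prop) (by fun_prop)
  have key : S.indicator h =ᵐ[volume] 0 := by
    refine ae_eq_zero_of_integral_char_eq_zero (hi.indicator hSm) fun η => ?_
    have hcm : Measurable fun x : EuclideanSpace ℝ (Fin n) =>
        Complex.exp ((inner ℝ η x : ℝ) * Complex.I) := by fun_prop
    have hki : ∀ s : Set (EuclideanSpace ℝ (Fin n)), MeasurableSet s → Integrable fun x =>
        s.indicator h x * Complex.exp ((inner ℝ η x : ℝ) * Complex.I) := fun s hs =>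
      (hi.indicator hs).mul_bdd hcm.aestronglyMeasurable
        (ae_of_all _ fun x => (Complex.norm_exp_ofReal_mul_I _).le)
    refine integral_eq_zero_of_isBoundedUnder_exp (v := fun x => inner ℝ e x - d')
      (M := M - d') (hki S hSm) (by fun_prop) (fun x hx => ?_) ?_
    · have hxS : x ∈ S := by
        by_contra hx'
        exact hx (by simp [hx'])
      have hx0 : h x ≠ 0 := by
        rintro hx'
        exact hx (by simp [hxS, hx'])
      refine ⟨sub_pos.2 hxS, ?_⟩
      have := real_inner_le_norm e x
      rw [he, one_mul] at this
      have := hM x hx0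
      linarith
    · obtain ⟨C, hC⟩ := exists_norm_integral_planeWave_mul_le hr hh hi hM hR η he hd'
      refine ⟨C + ∫ x, ‖h x‖, ?_⟩
      rw [eventually_map]
      filter_upwards [hC, eventually_ge_atTop 0] with t ht ht0
      -- The part of `h` in `⟪e, x⟫ ≤ d'` contributes at most `∫ ‖h‖`.
      set E : EuclideanSpace ℝ (Fin n) → ℂ := fun x =>
        Sᶜ.indicator h x * Complex.exp ((inner ℝ η x : ℝ) * Complex.I) *
          Complex.exp (t * (inner ℝ e x - d' : ℝ)) with hE
      have hEle : ∀ x, ‖E x‖ ≤ ‖h x‖ := by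
        intro x
        rw [hE]
        by_cases hx : x ∈ S
        · simp [hx]
        rw [norm_mul, norm_mul, Complex.norm_exp_ofReal_mul_I, mul_one,
          Set.indicator_of_mem (Set.mem_compl hx), ← Complex.ofReal_mul, Complex.norm_exp,
          Complex.ofReal_re]
        refine mul_le_of_le_one_right (norm_nonneg _) (Real.exp_le_one_iff.2 ?_)
        exact mul_nonpos_of_nonneg_of_nonpos ht0 (sub_nonpos.2 (not_lt.1 hx))
      have hEi : Integrable E := hi.norm.mono'
        ((hki Sᶜ hSm.compl).1.mul (by fun_prop : Measurable fun x : EuclideanSpace ℝ (Fin n) =>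
          Complex.exp (t * (inner ℝ e x - d' : ℝ))).aestronglyMeasurable) (ae_of_all _ hEle)
      have hsplit : ∀ x, S.indicator h x * Complex.exp ((inner ℝ η x : ℝ) * Complex.I) *
            Complex.exp (t * (inner ℝ e x - d' : ℝ)) =
          (Real.exp (-(d' * t)) : ℝ) * (planeWave η e t x * h x) - E x := by
        intro x
        have h1 : Complex.exp (t * (inner ℝ e x - d' : ℝ)) =
            (Real.exp (-(d' * t)) : ℝ) * Complex.exp (t * (inner ℝ e x : ℝ)) := by
          rw [Complex.ofReal_exp, ← Complex.exp_add]
          push_cast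
          ring_nf
        simp only [hE, h1, planeWave]
        by_cases hx : x ∈ S
        · simp [hx]
          ring
        · simp only [Set.indicator_of_notMem hx, Set.indicator_of_mem (Set.mem_compl hx)]
          ring
      simp_rw [hsplit]
      rw [integral_sub ((integrable_planeWave_mul hi hM η he ht0).const_mul _) hEi,
        integral_const_mul]
      refine (norm_sub_le _ _).trans (add_le_add ?_
        (norm_integral_le_of_norm_le hi.norm (ae_of_all _ hEle)))
      rw [norm_mul, Complex.norm_real, Real.norm_of_nonneg (Real.exp_pos _).le]
      refine (mul_le_mul_of_nonneg_left ht (Real.exp_pos _).le).trans_eq ?_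
      rw [mul_left_comm, ← Real.exp_add]
      simp
  filter_upwards [key] with x hx hxS
  simpa [show x ∈ S from hxS] using hx

theorem theorem4p15 (n : ℕ) (hn : 1 ≤ n) (d r : ℝ) (hd : 0 < d) (hdr : d < r)
    (f g : EuclideanSpace ℝ (Fin n) → ℂ)
    (hf : MemL2c (openAnnulus n d r) f) (hg : MemL2c (openAnnulus n d r) g)
    (h : ∀ᵐ y, y ∈ openAnnulus n (d + r) (2 * r) →
      sphericalRadon (fun _ => r) f y = sphericalRadon (fun _ => r) g y) :
    f =ᵐ[volume] g := by
  have hfi := hf.integrable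
  have hgi := hg.integrable
  obtain ⟨-, K₁, hK₁, hK₁U, hf0⟩ := hf
  obtain ⟨-, K₂, hK₂, hK₂U, hg0⟩ := hg
  set K := K₁ ∪ K₂
  have hK : IsCompact K := hK₁.union hK₂
  have hKU : K ⊆ openAnnulus n d r := Set.union_subset hK₁U hK₂U
  have hsub := hfi.sub hgi
  -- A strongly measurable representative of `f - g` that vanishes off `K` everywhere.
  set φ : EuclideanSpace ℝ (Fin n) → ℂ := K.indicator (hsub.1.mk (f - g)) with hφ
  have hφm : StronglyMeasurable φ := hsub.1.stronglyMeasurable_mk.indicator hK.measurableSet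
  have hφe : f - g =ᵐ[volume] φ := by
    filter_upwards [hsub.1.ae_eq_mk, hf0, hg0] with x hx h1 h2
    by_cases hxK : x ∈ K
    · rw [hφ, Set.indicator_of_mem hxK, hx]
    · rw [hφ, Set.indicator_of_notMem hxK, Pi.sub_apply, h1 fun h => hxK (Or.inl h),
        h2 fun h => hxK (Or.inr h), sub_zero]
  have hφK : ∀ x, φ x ≠ 0 → d < ‖x‖ ∧ ‖x‖ < r := fun x hx =>
    hKU (Set.mem_of_indicator_ne_zero hx)
  have hR : ∀ᵐ y, d + r < ‖y‖ → sphericalRadon (fun _ => r) φ y = 0 := by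
    filter_upwards [h, ae_eq_sphereSurfaceMeasure r hφe,
      ae_integrable_sphereSurfaceMeasure r hfi, ae_integrable_sphereSurfaceMeasure r hgi]
      with y hy hy1 hy2 hy3 hy4
    by_cases hy5 : ‖y‖ < 2 * r
    · rw [sphericalRadon, ← integral_congr_ae hy1]
      simp only [Pi.sub_apply]
      rw [integral_sub hy2 hy3, sub_eq_zero]
      exact hy ⟨hy4, hy5⟩
    -- For `‖y‖ ≥ 2 r` the sphere about `y` does not meet the ball `‖x‖ < r`.
    · rw [sphericalRadon_const_eq r (hd.trans hdr).le hφm]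
      have h0 : ∀ ω : Metric.sphere (0 : EuclideanSpace ℝ (Fin n)) 1,
          φ (y + r • (ω : EuclideanSpace ℝ (Fin n))) = 0 := by
        intro ω
        by_contra hne
        have h1 := (hφK _ hne).2
        have h2 := norm_sub_le_norm_add y (r • (ω : EuclideanSpace ℝ (Fin n)))
        have h3 : ‖(ω : EuclideanSpace ℝ (Fin n))‖ = 1 := by simp
        rw [norm_smul, h3, Real.norm_of_nonneg (hd.trans hdr).le] at h2
        linarith
      simp [h0]
  suffices hnull : volume {x | φ x ≠ 0} = 0 by
    filter_upwards [hφe, ae_iff.2 hnull] with x hx hx0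
    exact sub_eq_zero.1 (hx.trans hx0)
  refine measure_null_of_locally_null _ fun x hx => ?_
  have hdx : d < ‖x‖ := (hφK x hx).1
  have hx0 : 0 < ‖x‖ := hd.trans hdx
  set e := (‖x‖)⁻¹ • x with he
  have he1 : ‖e‖ = 1 := norm_smul_inv_norm (𝕜 := ℝ) (norm_pos_iff.1 hx0)
  obtain ⟨d', hd1, hd2⟩ := exists_between hdx
  have hex : d' < inner ℝ e x := by
    rw [he, inner_smul_left, real_inner_self_eq_norm_sq]
    simp [sq, hx0.ne', hd2]
  refine ⟨{y | φ y ≠ 0} ∩ {y | d' < inner ℝ e y}, ?_, ?_⟩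
  · exact Filter.inter_mem self_mem_nhdsWithin (mem_nhdsWithin_of_mem_nhds
      ((isOpen_lt continuous_const (by fun_prop)).mem_nhds hex))
  · have := ae_eq_zero_of_lt_inner (hd.trans hdr) hφm (hsub.congr hφe)
      (fun x hx => (hφK x hx).2.le) hR he1 hd1
    refine measure_mono_null ?_ (ae_iff.1 this)
    rintro y ⟨hy1, hy2⟩ hy3
    exact hy1 (hy3 hy2)
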